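/- **Setting.** Consider a finite stochastic game with random stopping: a finite non-empty set of players $i\in\mathcal N$, finite sets of states $\mathcal S$ and actions $\mathcal A_i$, rewards $r_i(s,a)\in[-1,1]$ for $a\in\mathcal A=\prod_i\mathcal A_i$, transition probabilities $P(s'\mid s,a)$ with stopping probability $1-\sum_{s'}P(s'\mid s,a)>0$ for all $s,a$, and an initial distribution $\rho$ on $\mathcal S$. Policies are $\pi=(\pi_i)_i\in\Pi=\prod_i\Delta(\mathcal A_i)^{\mathcal S}$, a subset of the Euclidean space $\mathcal Y=\prod_i\mathbb R^{\mathcal A_i\times\mathcal S}$. The value of player $i$ is the expected total reward of an episode, $$V_i(\pi)=\mathbb E_{s_0\sim\rho}\Big[\sum_{t=0}^{T}r_i(s_t,a_t)\Big]=\sum_{t\ge0}\sum_{s,a}\mathbb P^\pi(t\le T,\,s_t=s)\prod_j\pi_j(a_j\mid s)\,r_i(s,a),$$ where $T$ is the stopping time of the episode; the right-hand side is a convergent series also for real arrays $\pi$ near $\Pi$, and $v(\pi)=(\nabla_{\pi_i}V_i(\pi))_i\in\mathcal Y$ is the vector of its partial derivatives. A policy $\pi^*\in\Pi$ is *Nash*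 if $V_i(\pi^*)\ge V_i(\pi_i;\pi^*_{-i})$ for all $i$ and all $\pi_i$, and it is *strict Nash* if moreover it is deterministic and $\langle v(\pi^*),\pi-\pi^*\rangle<0$ for all $\pi\in\Pi$, $\pi\ne\pi^*$. *Lazy policy gradient (LPG)* is the process $$y_{n+1}=y_n+\gamma_n\hat v_n,\qquad \pi_n=\mathrm{proj}_\Pi(y_n),\qquad \gamma_n=\gamma/n^p,\qquad n=1,2,\dots,$$ on a probability space with a filtration $(\mathcal F_n)$ to which the scores $(y_n)$ are adapted (e.g. the history of $(y_n)$). Here $\mathrm{proj}_\Pi$ is the Euclidean projection, and the gradient estimates $\hat v_n$ are integrable, with noise $U_n=\hat v_n-\mathbb E[\hat v_n\mid\mathcal F_n]$ (square-integrable) and bias $b_n=\mathbb E[\hat v_n\mid\mathcal F_n]-v(\pi_n)$ satisfying almost surely $$\mathbb E[\|b_n\|\mid\mathcal F_n]\le B_n,\qquad \mathbb E[\|U_n\|^2\mid\mathcal F_n]\le\sigma_n^2,$$ for deterministic sequences $B_n=O(n^{-\ell_b})$ and $\sigma_n=O(n^{\ell_\sigma})$. **Theorem.** Let $\pi^*$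 be a strict Nash policy, let $p\le1$ (so that $\sum_n\gamma_n=\infty$), $p+\ell_b>1$ and $p-\ell_\sigma>1/2$, and let $B_n$, $\sigma_n$ be as above. Then there is an unbounded open set $\mathcal D\subseteq\mathcal Y$ such that for every $\delta>0$ there is $\gamma_0>0$ such that for all $\gamma\in(0,\gamma_0]$ there is $n_0$ for which every run of LPG with these parameters satisfies: 1. if $\mathbb P(y_1\in\mathcal D)>0$, then $\mathbb P(\pi_n\to\pi^*\mid y_1\in\mathcal D)\ge1-\delta$, and moreover $\mathbb P(\pi_n=\pi^*\text{ for all }n\ge n_0\mid y_1\in\mathcal D)\ge1-\delta$; 2. almost surely on the event $\{\pi_n\to\pi^*\}$, there is a finite (random) $m$ such that $\pi_n=\pi^*$ for all $n\ge m$. -/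

import Mathlib

open MeasureTheory ProbabilityTheory Filter Topology

/-- A finite stochastic game with random stopping: `ι` is the set of players, `S` the set of
states, `A i` the set of actions of player `i`. -/
structure StochasticGame (ι S : Type*) (A : ι → Type*) [Fintype S] where
  /-- `reward i s a` is the reward of player `i` at state `s` under the action profile `a`. -/
  reward : ι → S → (∀ i, A i) → ℝ
  reward_mem : ∀ i s a, reward i s a ∈ Set.Icc (-1 : ℝ) 1
  /-- `trans s a s'` is the probability of moving from `s` to `s'` under the profile `a`. -/
  trans : S → (∀ i, A i) → S → ℝ
  trans_nonneg : ∀ s a s', 0 ≤ trans s a s'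
  /-- At every state and action profile the game stops with positive probability
  `1 - ∑ s', trans s a s'`. -/
  stop_pos : ∀ s a, 0 < 1 - ∑ s', trans s a s'
  /-- The distribution of the initial state. -/
  init : S → ℝ
  init_nonneg : ∀ s, 0 ≤ init s
  init_sum : ∑ s, init s = 1

/-- The ambient Euclidean space `∏ i, ℝ^(S × A i)` in which scores, policies and gradients live.
The coordinate `x ⟨i, s, a⟩` is the entry of player `i` at state `s` and action `a`. -/
abbrev ScoreSpace (ι S : Type*) (A : ι → Type*) : Type _ :=
  EuclideanSpace ℝ ((i : ι) × S × A i)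

section Policies

variable {ι S : Type*} {A : ι → Type*} [∀ i, Fintype (A i)]

/-- The set of stationary Markovian policy profiles: `x ⟨i, s, ·⟩` is a probability distribution
on `A i` for all players `i` and states `s`. -/
def policies (ι S : Type*) (A : ι → Type*) [∀ i, Fintype (A i)] : Set (ScoreSpace ι S A) :=
  {x | ∀ i s, (∀ a, 0 ≤ x ⟨i, s, a⟩) ∧ ∑ a, x ⟨i, s, a⟩ = 1}

/-- The policy profile `x` selects one action of each player at each state. -/
def IsDeterministic (x : ScoreSpace ι S A) : Prop :=
  x ∈ policies ι S A ∧ ∀ i s, ∃ a, x ⟨i, s, a⟩ = 1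

end Policies

/-- The profile `(x'_i; x_{-i})`: player `i` plays as in `x'`, all others play as in `x`. -/
def deviate {ι S : Type*} {A : ι → Type*} [DecidableEq ι]
    (x : ScoreSpace ι S A) (i : ι) (x' : ScoreSpace ι S A) : ScoreSpace ι S A :=
  WithLp.toLp 2 fun k => if k.1 = i then x' k else x k

/-- `x` is the Euclidean projection of `y` on the set `C`: the point of `C` nearest to `y`. -/
def IsProjection {E : Type*} [PseudoMetricSpace E] (C : Set E) (y x : E) : Prop :=
  x ∈ C ∧ ∀ z ∈ C, dist y x ≤ dist y z

namespace StochasticGame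

variable {ι S : Type*} {A : ι → Type*} [Fintype ι] [DecidableEq ι] [Fintype S]
  [∀ i, Fintype (A i)]

/-- Probability that the action profile `a` is played at state `s` (players randomize
independently). -/
def actionProb (x : ScoreSpace ι S A) (s : S) (a : ∀ i, A i) : ℝ :=
  ∏ i, x ⟨i, s, a i⟩

open Classical in
/-- Probability that an episode started at `s₀` has not stopped before time `t` and is at state
`s` at time `t`, when the players follow `x`. -/
noncomputable def visitProb (G : StochasticGame ι S A) (x : ScoreSpace ι S A) (s₀ : S) :
    ℕ → S → ℝ
  | 0, s => if s = s₀ then 1 else 0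
  | t + 1, s' => ∑ s, ∑ a, G.visitProb x s₀ t s * actionProb x s a * G.trans s a s'

/-- The value function of player `i` for the initial state `s₀`: the expected total reward
`E[∑_{t ≤ T} r_i(s_t, a_t) | s_0 = s₀]` of an episode, summed over time. The formula makes sense
for all real arrays in a neighborhood of the set of policies (where the series still converges),
so that partial derivatives with respect to the entries of a policy can be taken. -/
noncomputable def stateValue (G : StochasticGame ι S A) (i : ι) (s₀ : S)
    (x : ScoreSpace ι S A) : ℝ :=
  ∑' t : ℕ, ∑ s, ∑ a, G.visitProb x s₀ t s * actionProb x s a * G.reward i s a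

/-- The value function of player `i` for the initial distribution of the game. -/
noncomputable def value (G : StochasticGame ι S A) (i : ι) (x : ScoreSpace ι S A) : ℝ :=
  ∑ s₀, G.init s₀ * G.stateValue i s₀ x

/-- The ensemble of individual policy gradients: the block of player `i` is the gradient of
player `i`'s own value function with respect to player `i`'s own policy. -/
noncomputable def policyGradient (G : StochasticGame ι S A) (x : ScoreSpace ι S A) :
    ScoreSpace ι S A :=
  WithLp.toLp 2 fun k => gradient (G.value k.1) x k

/-- Nash policies: no player can gain by a unilateral deviation. -/
def IsNash (G : StochasticGame ι S A) (x : ScoreSpace ι S A) : Prop :=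
  x ∈ policies ι S A ∧
    ∀ i, ∀ x' ∈ policies ι S A, G.value i (deviate x i x') ≤ G.value i x

/-- Strict Nash policies: deterministic Nash policies at which the first-order stationarity
condition is a strict inequality. -/
def IsStrictNash (G : StochasticGame ι S A) (x : ScoreSpace ι S A) : Prop :=
  G.IsNash x ∧ IsDeterministic x ∧
    ∀ x' ∈ policies ι S A, x' ≠ x → inner ℝ (G.policyGradient x) (x' - x) < 0

section LPG

variable {Ω : Type*} {mΩ : MeasurableSpace Ω}

/-- The step-size `γ / n^p` of the `n`-th iteration, `n = k + 1 = 1, 2, …`. -/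
noncomputable def stepSize (γ p : ℝ) (k : ℕ) : ℝ := γ / ((k : ℝ) + 1) ^ p

/-- The noise `v̂ₖ - E[v̂ₖ | ℱₖ]` of a gradient estimate. -/
noncomputable def noise (P : Measure Ω) (ℱ : Filtration ℕ mΩ) (v : ℕ → Ω → ScoreSpace ι S A)
    (k : ℕ) (ω : Ω) : ScoreSpace ι S A :=
  v k ω - (P[v k | ℱ k]) ω

/-- The bias `E[v̂ₖ | ℱₖ] - v(πₖ)` of a gradient estimate. -/
noncomputable def bias (G : StochasticGame ι S A) (P : Measure Ω) (ℱ : Filtration ℕ mΩ)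
    (v π : ℕ → Ω → ScoreSpace ι S A) (k : ℕ) (ω : Ω) : ScoreSpace ι S A :=
  (P[v k | ℱ k]) ω - G.policyGradient (π k ω)

/-- The processes `y` (scores), `π` (policies) and `v` (gradient estimates) form a run of lazy
policy gradient with step-sizes `γ / n^p` and gradient estimates whose bias and noise are bounded
by `B` and `σ`. Index `k : ℕ` stands for the iteration `n = k + 1`, so `y 0` is the
initialization. -/
structure IsLPG (G : StochasticGame ι S A) (P : Measure Ω) (ℱ : Filtration ℕ mΩ) (γ p : ℝ)
    (B σ : ℕ → ℝ) (y π v : ℕ → Ω → ScoreSpace ι S A) : Prop where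
  measurable_score : ∀ k, StronglyMeasurable[ℱ k] (y k)
  score_succ : ∀ k ω, y (k + 1) ω = y k ω + stepSize γ p k • v k ω
  policy_eq : ∀ k ω, IsProjection (policies ι S A) (y k ω) (π k ω)
  integrable_estimate : ∀ k, Integrable (v k) P
  integrable_noise_sq : ∀ k, Integrable (fun ω => ‖noise P ℱ v k ω‖ ^ 2) P
  bias_le : ∀ k, P[fun ω => ‖G.bias P ℱ v π k ω‖ | ℱ k] ≤ᵐ[P] fun _ => B k
  noise_le : ∀ k, P[fun ω => ‖noise P ℱ v k ω‖ ^ 2 | ℱ k] ≤ᵐ[P] fun _ => σ k ^ 2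

end LPG

end StochasticGame

/-! A deterministic policy is a vertex of a product of simplices, so a neighbourhood of scores deep
in its normal cone projects exactly onto it: `IsProjection.eq_of_entryGap_le` needs only that at
each player and state the chosen action's score leads every other by 1. At a strict Nash policy the
individual gradients widen all these leads (`entryGap_neg_of_inner_neg`), so it suffices to follow
finitely many real processes, the gaps of `y n`. By `IsLPG.map_score` each is its initial value plus
drift, noise and bias.

Bias sums are bounded because `p + b > 1`. Noise sums are martingales bounded in L² because `p - s >
1/2`, so Kolmogorov's inequality controls them over the infinite horizon, with failure probability
of order `γ ^ 2`. Starting from a lead above 2, noise and bias of at most 1/2 each leave a lead of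
1. The policy then never moves and the drift never hurts (`policy_eq_of_noise_le`,
`le_cond_forall_eq`).

If the policies merely converge, continuity of the gradient gives an eventually strictly negative
drift. As the step sizes sum to infinity, it overwhelms the bounded errors, and the projection
reaches the vertex in finite time (`ae_eventually_eq_of_tendsto`). -/

/-! ### Smoothness of the value functions near the policies. -/

section Smoothness

open scoped Matrix.Norms.Operator

namespace StochasticGame

variable {ι S : Type*} {A : ι → Type*} [Fintype ι] [∀ i, Fintype (A i)]

lemma contDiff_actionProb [Fintype S] (s : S) (a : ∀ i, A i) {n : WithTop ℕ∞} :
    ContDiff ℝ n fun x : ScoreSpace ι S A => actionProb x s a := by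
  unfold actionProb
  fun_prop

lemma actionProb_nonneg {x : ScoreSpace ι S A} (hx : x ∈ policies ι S A) (s : S)
    (a : ∀ i, A i) : 0 ≤ actionProb x s a :=
  Finset.prod_nonneg fun i _ => (hx i s).1 (a i)

variable [DecidableEq ι]

lemma sum_actionProb {x : ScoreSpace ι S A} (hx : x ∈ policies ι S A) (s : S) :
    ∑ a, actionProb x s a = 1 := by
  have h := Finset.prod_univ_sum (fun i => (Finset.univ : Finset (A i)))
    (fun i a => x ⟨i, s, a⟩)
  rw [Fintype.piFinset_univ] at h
  unfold actionProb
  rw [← h]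
  exact Finset.prod_eq_one fun i _ => (hx i s).2

variable [Fintype S]

/-- The (sub-stochastic) transition matrix of the states when the players follow `x`. -/
noncomputable def transMatrix (G : StochasticGame ι S A) (x : ScoreSpace ι S A) :
    Matrix S S ℝ :=
  Matrix.of fun s s' => ∑ a, actionProb x s a * G.trans s a s'

/-- The expected one-step reward of player `i` at state `s` when the players follow `x`. -/
noncomputable def stageReward (G : StochasticGame ι S A) (i : ι) (x : ScoreSpace ι S A)
    (s : S) : ℝ :=
  ∑ a, actionProb x s a * G.reward i s a

open Classical in
lemma visitProb_eq_transMatrix_pow (G : StochasticGame ι S A) (x : ScoreSpace ι S A) (s₀ : S)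
    (t : ℕ) (s : S) : G.visitProb x s₀ t s = (G.transMatrix x ^ t) s₀ s := by
  induction t generalizing s with
  | zero => simp [visitProb, Matrix.one_apply, eq_comm]
  | succ t ih =>
    simp only [visitProb, pow_succ, Matrix.mul_apply, ih, transMatrix, Matrix.of_apply,
      Finset.mul_sum, mul_assoc]

lemma contDiff_stageReward (G : StochasticGame ι S A) (i : ι) (s : S) {n : WithTop ℕ∞} :
    ContDiff ℝ n fun x => G.stageReward i x s :=
  ContDiff.sum fun a _ => (contDiff_actionProb s a).mul contDiff_const

open Classical in
lemma contDiff_transMatrix (G : StochasticGame ι S A) {n : WithTop ℕ∞} :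
    ContDiff ℝ n G.transMatrix := by
  have h : G.transMatrix = fun x => ∑ s, ∑ s',
      (∑ a, actionProb x s a * G.trans s a s') • Matrix.single s s' (1 : ℝ) := by
    funext x
    conv_lhs => rw [Matrix.matrix_eq_sum_single (G.transMatrix x)]
    simp [transMatrix]
  rw [h]
  exact ContDiff.sum fun s _ => ContDiff.sum fun s' _ =>
    (ContDiff.sum fun a _ => (contDiff_actionProb s a).mul contDiff_const).smul contDiff_const

/-- The norm is the largest absolute row sum. Each row sum averages continuation probabilities, all
below 1, over action profiles; strictness comes from a profile played with positive probability. -/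
lemma norm_transMatrix_lt_one (G : StochasticGame ι S A) {x : ScoreSpace ι S A}
    (hx : x ∈ policies ι S A) : ‖G.transMatrix x‖ < 1 := by
  rw [← coe_nnnorm, ← NNReal.coe_one, NNReal.coe_lt_coe, Matrix.linfty_opNNNorm_def,
    Finset.sup_lt_iff (by simp)]
  intro s _
  rw [← NNReal.coe_lt_coe]
  push_cast
  have hent : ∀ s', ‖G.transMatrix x s s'‖ = ∑ a, actionProb x s a * G.trans s a s' :=
    fun s' => Real.norm_of_nonneg
      (Finset.sum_nonneg fun a _ => mul_nonneg (actionProb_nonneg hx s a) (G.trans_nonneg _ _ _))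
  simp only [hent]
  rw [Finset.sum_comm, ← sum_actionProb hx s]
  simp only [← Finset.mul_sum]
  obtain ⟨a, ha⟩ : ∃ a, 0 < actionProb x s a := by
    by_contra! h
    have := Finset.sum_nonpos fun a (_ : a ∈ Finset.univ) => h a
    rw [sum_actionProb hx s] at this
    linarith
  refine Finset.sum_lt_sum (fun a _ => ?_) ⟨a, Finset.mem_univ _, ?_⟩
  · nlinarith [G.stop_pos s a, actionProb_nonneg hx s a]
  · nlinarith [G.stop_pos s a]

open Classical in
-- Neumann series: summing over time inverts `1 - G.transMatrix x`, which leaves only polynomials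
-- and a matrix inverse to differentiate.
lemma value_eq_of_norm_lt_one (G : StochasticGame ι S A) (i : ι) {x : ScoreSpace ι S A}
    (hx : ‖G.transMatrix x‖ < 1) :
    G.value i x = ∑ s₀, G.init s₀ *
      ∑ s, Ring.inverse (1 - G.transMatrix x) s₀ s * G.stageReward i x s := by
  unfold value stateValue
  refine Finset.sum_congr rfl fun s₀ _ => ?_
  congr 1
  have h : HasSum (fun t => G.transMatrix x ^ t) (Ring.inverse (1 - G.transMatrix x)) :=
    hasSum_geom_series_inverse _ hx
  refine HasSum.tsum_eq ?_
  have h' : ∀ t, ∑ s, ∑ a, G.visitProb x s₀ t s * actionProb x s a * G.reward i s a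
      = ∑ s, (G.transMatrix x ^ t) s₀ s * G.stageReward i x s := fun t => by
    simp only [stageReward, Finset.mul_sum, visitProb_eq_transMatrix_pow, mul_assoc]
  simp only [h']
  refine hasSum_sum fun s _ => HasSum.mul_right _ ?_
  exact h.mapL (Matrix.entryLinearMap ℝ ℝ s₀ s).toContinuousLinearMap

open Classical in
-- The norm condition is open, so the closed formula holds on a full neighbourhood in the ambient
-- space, where inversion is smooth.
lemma contDiffAt_value (G : StochasticGame ι S A) (i : ι) {x : ScoreSpace ι S A}
    (hx : x ∈ policies ι S A) {n : WithTop ℕ∞} : ContDiffAt ℝ n (G.value i) x := by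
  have hev : G.value i =ᶠ[𝓝 x] fun x => ∑ s₀, G.init s₀ *
      ∑ s, Ring.inverse (1 - G.transMatrix x) s₀ s * G.stageReward i x s := by
    have hc : Continuous fun x => ‖G.transMatrix x‖ :=
      (G.contDiff_transMatrix (n := 0)).continuous.norm
    filter_upwards [hc.continuousAt.eventually_lt_const (G.norm_transMatrix_lt_one hx)] with z hz
    exact G.value_eq_of_norm_lt_one i hz
  refine ContDiffAt.congr_of_eventuallyEq ?_ hev
  have hinv : ContDiffAt ℝ n (fun x => Ring.inverse (1 - G.transMatrix x)) x := by
    obtain ⟨u, hu⟩ : IsUnit (1 - G.transMatrix x) :=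
      isUnit_one_sub_of_norm_lt_one (G.norm_transMatrix_lt_one hx)
    have := contDiffAt_ringInverse ℝ (n := n) u
    rw [hu] at this
    exact this.comp x (contDiff_const.sub G.contDiff_transMatrix).contDiffAt
  refine ContDiffAt.sum fun s₀ _ => contDiffAt_const.mul (ContDiffAt.sum fun s _ => ?_)
  refine ContDiffAt.mul ?_ (G.contDiff_stageReward i s).contDiffAt
  exact (Matrix.entryLinearMap ℝ ℝ s₀ s).toContinuousLinearMap.contDiff.contDiffAt.comp x hinv

lemma continuousOn_policyGradient (G : StochasticGame ι S A) :
    ContinuousOn G.policyGradient (policies ι S A) := by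
  intro x hx
  refine ContinuousAt.continuousWithinAt ?_
  unfold policyGradient
  refine (PiLp.continuous_toLp 2 _).continuousAt.comp (continuousAt_pi.2 fun k => ?_)
  have h : ContinuousAt (fderiv ℝ (G.value k.1)) x :=
    ((G.contDiffAt_value k.1 hx (n := 1)).fderiv_right (m := 0) (by simp)).continuousAt
  have h' : ContinuousAt (gradient (G.value k.1)) x :=
    (InnerProductSpace.toDual ℝ (ScoreSpace ι S A)).symm.continuous.continuousAt.comp h
  exact (EuclideanSpace.proj k : ScoreSpace ι S A →L[ℝ] ℝ).continuous.continuousAt.comp h'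

end StochasticGame

end Smoothness

/-! ### Euclidean projection on convex sets. -/

section Projection

variable {E : Type*} [NormedAddCommGroup E] [InnerProductSpace ℝ E]

lemma IsProjection.inner_le_zero {C : Set E} (hC : Convex ℝ C) {y x : E}
    (h : IsProjection C y x) {z : E} (hz : z ∈ C) : inner ℝ (y - x) (z - x) ≤ 0 := by
  refine (norm_eq_iInf_iff_real_inner_le_zero hC h.1).1 ?_ z hz
  have : Nonempty C := ⟨⟨x, h.1⟩⟩
  refine le_antisymm (le_ciInf fun w => ?_) (ciInf_le ⟨0, ?_⟩ (⟨x, h.1⟩ : C))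
  · simpa [dist_eq_norm] using h.2 w w.2
  · rintro _ ⟨w, rfl⟩
    exact norm_nonneg _

/-- Add the two variational inequalities and apply Cauchy–Schwarz. The case `y = y'` is uniqueness
of the projection. -/
lemma IsProjection.dist_le_dist {C : Set E} (hC : Convex ℝ C) {y x y' x' : E}
    (h : IsProjection C y x) (h' : IsProjection C y' x') : dist x x' ≤ dist y y' := by
  have h1 := h.inner_le_zero hC h'.1
  have h2 := h'.inner_le_zero hC h.1
  have h3 : ‖x - x'‖ * ‖x - x'‖ ≤ inner ℝ (y - y') (x - x') := by
    rw [← real_inner_self_eq_norm_mul_norm]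
    have e : inner ℝ (y - y') (x - x') = inner ℝ (x - x') (x - x')
        - inner ℝ (y - x) (x' - x) - inner ℝ (y' - x') (x - x') := by
      rw [← neg_sub x x', inner_neg_right, sub_neg_eq_add, ← inner_add_left, ← inner_sub_left]
      congr 1
      abel
    linarith
  have h4 := h3.trans (real_inner_le_norm _ _)
  rw [dist_eq_norm, dist_eq_norm]
  by_contra! hlt
  nlinarith [norm_nonneg (x - x'), norm_nonneg (y - y')]

lemma exists_isProjection_continuous {C : Set E} (hC : Convex ℝ C) (hK : IsCompact C)
    (hne : C.Nonempty) : ∃ f : E → E, Continuous f ∧ ∀ y, IsProjection C y (f y) := by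
  have h : ∀ y, ∃ x, IsProjection C y x := fun y => by
    obtain ⟨x, hx, hmin⟩ := hK.exists_isMinOn hne
      (f := fun z => dist y z) (by fun_prop)
    exact ⟨x, hx, fun z hz => hmin hz⟩
  choose f hf using h
  refine ⟨f, ?_, hf⟩
  exact (LipschitzWith.of_dist_le_mul (K := 1) fun a b => by
    simpa using (hf a).dist_le_dist hC (hf b)).continuous

end Projection

/-! ### Geometry of the policy polytope at a vertex. -/

section Policies

variable {ι S : Type*} {A : ι → Type*}

/-- The difference of the entries of player `i` at state `s` for the actions `a` and `a'`. -/
noncomputable def entryGap (i : ι) (s : S) (a a' : A i) : ScoreSpace ι S A →L[ℝ] ℝ :=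
  EuclideanSpace.proj ⟨i, s, a⟩ - EuclideanSpace.proj ⟨i, s, a'⟩

@[simp]
lemma entryGap_apply (i : ι) (s : S) (a a' : A i) (x : ScoreSpace ι S A) :
    entryGap i s a a' x = x ⟨i, s, a⟩ - x ⟨i, s, a'⟩ := rfl

variable [∀ i, Fintype (A i)]

lemma eq_zero_of_eq_one {x : ScoreSpace ι S A} (hx : x ∈ policies ι S A) {i : ι} {s : S}
    {a a' : A i} (h : x ⟨i, s, a⟩ = 1) (hne : a' ≠ a) : x ⟨i, s, a'⟩ = 0 := by
  classical
  have h1 := (hx i s).2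
  rw [← Finset.add_sum_erase _ _ (Finset.mem_univ a), h] at h1
  have h2 : ∑ b ∈ Finset.univ.erase a, x ⟨i, s, b⟩ = 0 := by linarith
  exact (Finset.sum_eq_zero_iff_of_nonneg fun b _ => (hx i s).1 b).1 h2 a' (by simp [hne])

lemma convex_policies : Convex ℝ (policies ι S A) := by
  intro x hx y hy a b ha hb hab i s
  refine ⟨fun c => ?_, ?_⟩
  · have := (hx i s).1 c
    have := (hy i s).1 c
    simp only [PiLp.add_apply, PiLp.smul_apply, smul_eq_mul]
    positivity
  · simp only [PiLp.add_apply, PiLp.smul_apply, smul_eq_mul, Finset.sum_add_distrib,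
      ← Finset.mul_sum, (hx i s).2, (hy i s).2, mul_one, hab]

open Classical in
lemma sum_single_apply (i j : ι) (s s' : S) (a : A i) :
    ∑ c, (EuclideanSpace.single ⟨i, s, a⟩ 1 : ScoreSpace ι S A) ⟨j, s', c⟩ =
      if j = i ∧ s' = s then 1 else 0 := by
  by_cases hj : j = i
  · subst hj
    by_cases hs : s' = s <;> simp [hs]
  · simp [hj]

variable [Fintype ι] [Fintype S]

lemma isCompact_policies : IsCompact (policies ι S A) := by
  refine Metric.isCompact_of_isClosed_isBounded ?_ ?_
  · have : policies ι S A = ⋂ i, ⋂ s, (⋂ a, {x | 0 ≤ x ⟨i, s, a⟩}) ∩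
        {x | ∑ a, x ⟨i, s, a⟩ = 1} := by
      ext x
      simp [policies]
    rw [this]
    refine isClosed_iInter fun i => isClosed_iInter fun s => IsClosed.inter
      (isClosed_iInter fun a => isClosed_le (by fun_prop) (by fun_prop))
      (isClosed_eq (by fun_prop) (by fun_prop))
  · rw [isBounded_iff_forall_norm_le]
    refine ⟨√(∑ _k : (i : ι) × S × A i, 1), fun x hx => ?_⟩
    rw [EuclideanSpace.norm_eq]
    refine Real.sqrt_le_sqrt (Finset.sum_le_sum ?_)
    rintro ⟨i, s, a⟩ _
    have h0 := (hx i s).1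
    have h1 : x ⟨i, s, a⟩ ≤ 1 := (hx i s).2 ▸
      Finset.single_le_sum (fun b _ => h0 b) (Finset.mem_univ a)
    rw [Real.norm_of_nonneg (h0 a)]
    nlinarith [h0 a]

lemma abs_entryGap_le (i : ι) (s : S) (a a' : A i) (x : ScoreSpace ι S A) :
    |entryGap i s a a' x| ≤ 2 * ‖x‖ := by
  have h1 := PiLp.norm_apply_le x ⟨i, s, a⟩
  have h2 := PiLp.norm_apply_le x ⟨i, s, a'⟩
  rw [Real.norm_eq_abs] at h1 h2
  rw [entryGap_apply]
  linarith [abs_sub (x ⟨i, s, a⟩) (x ⟨i, s, a'⟩)]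

/-- A score whose entries at the actions of a deterministic policy exceed all others by at
least one is projected on that policy. -/
lemma IsProjection.eq_of_entryGap_le {x : ScoreSpace ι S A} (hx : x ∈ policies ι S A)
    {α : ∀ i, S → A i} (hα : ∀ i s, x ⟨i, s, α i s⟩ = 1) {y z : ScoreSpace ι S A}
    (hz : IsProjection (policies ι S A) y z)
    (hy : ∀ i s a, a ≠ α i s → entryGap i s a (α i s) y ≤ -1) : z = x := by
  have hmin := hz.2 x hx
  have hinner : 0 ≤ inner ℝ (y - x) (x - z) := by
    simp only [PiLp.inner_apply, Fintype.sum_sigma, Fintype.sum_prod_type]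
    refine Finset.sum_nonneg fun i _ => Finset.sum_nonneg fun s _ => ?_
    -- Both rows sum to 1, so subtracting a constant from a row of `y - x` does not change the
    -- pairing with `x - z`. With this constant every remaining term is nonnegative.
    have h0 : ∑ a, (y ⟨i, s, α i s⟩ - 1) * (x ⟨i, s, a⟩ - z ⟨i, s, a⟩) = 0 := by
      rw [← Finset.mul_sum, Finset.sum_sub_distrib, (hx i s).2, (hz.1 i s).2]
      ring
    rw [← h0]
    refine Finset.sum_le_sum fun a _ => ?_
    simp only [PiLp.sub_apply, RCLike.inner_apply, conj_trivial]
    by_cases ha : a = α i s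
    · rw [ha, hα, mul_comm]
    · have h1 := hy i s a ha
      rw [entryGap_apply] at h1
      rw [eq_zero_of_eq_one hx (hα i s) ha]
      nlinarith [(hz.1 i s).1 a]
  have hexp : ‖y - z‖ ^ 2 = ‖y - x‖ ^ 2 + 2 * inner ℝ (y - x) (x - z) + ‖x - z‖ ^ 2 := by
    rw [← norm_add_sq_real]
    congr 2
    abel
  rw [dist_eq_norm, dist_eq_norm] at hmin
  have h2 : ‖x - z‖ ^ 2 ≤ 0 := by nlinarith [norm_nonneg (y - z), norm_nonneg (y - x)]
  have h3 : ‖x - z‖ = 0 := by nlinarith [norm_nonneg (x - z)]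
  exact (sub_eq_zero.1 (norm_eq_zero.1 h3)).symm

/-- Test with the vertex obtained by moving all mass at `(i, s)` from `α i s` to `a`; the pairing of
`g` with this displacement is exactly the gap. -/
lemma entryGap_neg_of_inner_neg {x g : ScoreSpace ι S A} (hx : x ∈ policies ι S A)
    {α : ∀ i, S → A i} (hα : ∀ i s, x ⟨i, s, α i s⟩ = 1)
    (h : ∀ x' ∈ policies ι S A, x' ≠ x → inner ℝ g (x' - x) < 0) (i : ι) (s : S) (a : A i)
    (ha : a ≠ α i s) : entryGap i s a (α i s) g < 0 := by
  classical
  set d : ScoreSpace ι S A :=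
    EuclideanSpace.single ⟨i, s, a⟩ 1 - EuclideanSpace.single ⟨i, s, α i s⟩ 1 with hd
  have hda : d ⟨i, s, a⟩ = 1 := by simp [hd, ha]
  have hmem : x + d ∈ policies ι S A := by
    intro j s'
    refine ⟨fun c => ?_, ?_⟩
    · by_cases hk : (⟨j, s', c⟩ : (i : ι) × S × A i) = ⟨i, s, α i s⟩
      · rw [hk, PiLp.add_apply, hα]
        simp [hd, ha.symm]
      · simp only [hd, PiLp.add_apply, PiLp.sub_apply, PiLp.single_apply, if_neg hk, sub_zero]
        have := (hx j s').1 c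
        split_ifs <;> linarith
    · simp only [hd, PiLp.add_apply, PiLp.sub_apply, Finset.sum_add_distrib,
        Finset.sum_sub_distrib, sum_single_apply, (hx j s').2]
      ring
  have hne : x + d ≠ x := fun h => by
    have : d = 0 := by simpa using h
    rw [this] at hda
    simp at hda
  have := h _ hmem hne
  rw [add_sub_cancel_left, hd, inner_sub_right] at this
  simpa [EuclideanSpace.inner_single_right] using this

end Policies

/-! ### Maximal inequalities for square-integrable martingales. -/

section MartingaleDifference

variable {Ω : Type*} {mΩ : MeasurableSpace Ω}

/-- A square-integrable martingale difference sequence; the `k`-th increment becomes known at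
time `k + 1`. -/
structure IsMartingaleDifference (P : Measure Ω) (ℱ : Filtration ℕ mΩ) (ξ : ℕ → Ω → ℝ) :
    Prop where
  measurable : ∀ k, StronglyMeasurable[ℱ (k + 1)] (ξ k)
  memLp : ∀ k, MemLp (ξ k) 2 P
  condExp_eq_zero : ∀ k, P[ξ k | ℱ k] =ᵐ[P] 0

namespace IsMartingaleDifference

variable {P : Measure Ω} {ℱ : Filtration ℕ mΩ} {ξ : ℕ → Ω → ℝ}

lemma stronglyMeasurable_sum (h : IsMartingaleDifference P ℱ ξ) (n : ℕ) :
    StronglyMeasurable[ℱ n] (∑ k ∈ Finset.range n, ξ k) :=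
  Finset.stronglyMeasurable_sum _ fun k hk =>
    (h.measurable k).mono (ℱ.mono (Finset.mem_range.1 hk))

lemma memLp_sum (h : IsMartingaleDifference P ℱ ξ) (n : ℕ) :
    MemLp (∑ k ∈ Finset.range n, ξ k) 2 P :=
  memLp_finsetSum' _ fun k _ => h.memLp k

lemma integrable_sum_mul (h : IsMartingaleDifference P ℱ ξ) (n : ℕ) :
    Integrable ((∑ k ∈ Finset.range n, ξ k) * ξ n) P :=
  (h.memLp_sum n).integrable_mul (h.memLp n)

variable [IsFiniteMeasure P]

lemma condExp_sum_mul (h : IsMartingaleDifference P ℱ ξ) (n : ℕ) :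
    P[(∑ k ∈ Finset.range n, ξ k) * ξ n | ℱ n] =ᵐ[P] 0 := by
  filter_upwards [condExp_mul_of_stronglyMeasurable_left (h.stronglyMeasurable_sum n)
    (h.integrable_sum_mul n) ((h.memLp n).integrable one_le_two), h.condExp_eq_zero n]
    with ω h1 h2
  rw [h1, Pi.mul_apply, h2]
  simp

/-- Increments are orthogonal: the past sum is known at time `n`, so its product with `ξ n` has mean
zero. -/
lemma integral_sum_sq (h : IsMartingaleDifference P ℱ ξ) (n : ℕ) :
    ∫ ω, (∑ k ∈ Finset.range n, ξ k ω) ^ 2 ∂P = ∑ k ∈ Finset.range n, ∫ ω, ξ k ω ^ 2 ∂P := by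
  induction n with
  | zero => simp
  | succ n ih =>
    have h0 : ∫ ω, (∑ k ∈ Finset.range n, ξ k ω) * ξ n ω ∂P = 0 := by
      have := integral_condExp (μ := P) (f := (∑ k ∈ Finset.range n, ξ k) * ξ n) (ℱ.le n)
      rw [integral_congr_ae (h.condExp_sum_mul n)] at this
      simpa using this.symm
    have e : ∀ ω, (∑ k ∈ Finset.range (n + 1), ξ k ω) ^ 2 = (∑ k ∈ Finset.range n, ξ k ω) ^ 2
        + 2 * ((∑ k ∈ Finset.range n, ξ k ω) * ξ n ω) + ξ n ω ^ 2 := fun ω => by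
      rw [Finset.sum_range_succ]
      ring
    have i1 := (h.memLp_sum n).integrable_sq
    have i2 := (h.integrable_sum_mul n).const_mul 2
    simp only [Pi.mul_apply, Finset.sum_apply] at i1 i2
    have i12 := integral_add (i1.add i2) (h.memLp n).integrable_sq
    simp only [Pi.add_apply] at i12
    simp only [e]
    rw [i12, integral_add i1 i2, integral_const_mul, h0, ih, Finset.sum_range_succ]
    ring

lemma submartingale_sum_sq (h : IsMartingaleDifference P ℱ ξ) :
    Submartingale (fun n ω => (∑ k ∈ Finset.range n, ξ k ω) ^ 2) ℱ P := by
  refine submartingale_of_condExp_sub_nonneg_nat (fun n => ?_) (fun n => ?_) fun n => ?_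
  · have := (h.stronglyMeasurable_sum n).pow 2
    convert this using 1
    funext ω
    simp
  · simpa using (h.memLp_sum n).integrable_sq
  · have e : ((fun ω => (∑ k ∈ Finset.range (n + 1), ξ k ω) ^ 2) -
        fun ω => (∑ k ∈ Finset.range n, ξ k ω) ^ 2) =
        (2 : ℝ) • ((∑ k ∈ Finset.range n, ξ k) * ξ n) + fun ω => ξ n ω ^ 2 := by
      funext ω
      simp only [Pi.sub_apply, Pi.add_apply, Pi.smul_apply, Pi.mul_apply, Finset.sum_apply,
        Finset.sum_range_succ, smul_eq_mul]
      ring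
    rw [e]
    filter_upwards [condExp_add ((h.integrable_sum_mul n).smul (2 : ℝ))
        (h.memLp n).integrable_sq (ℱ n),
      condExp_smul (μ := P) (2 : ℝ) ((∑ k ∈ Finset.range n, ξ k) * ξ n) (ℱ n),
      h.condExp_sum_mul n,
      condExp_nonneg (μ := P) (m := ℱ n) (f := fun ω => ξ n ω ^ 2)
        (ae_of_all _ fun ω => sq_nonneg _)] with ω h1 h2 h3 h4
    rw [h1, Pi.add_apply, h2, Pi.smul_apply, h3]
    simpa using h4

/-- Kolmogorov's maximal inequality over an infinite horizon. -/
lemma measure_exists_le_abs_sum (h : IsMartingaleDifference P ℱ ξ) {T ε : ℝ} (hε : 0 < ε)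
    (hT : ∀ n, ∑ k ∈ Finset.range n, ∫ ω, ξ k ω ^ 2 ∂P ≤ T) :
    P {ω | ∃ n, ε ≤ |∑ k ∈ Finset.range n, ξ k ω|} ≤ ENNReal.ofReal (T / ε ^ 2) := by
  have hU : {ω | ∃ n, ε ≤ |∑ k ∈ Finset.range n, ξ k ω|} =
      ⋃ n, {ω | ∃ k ∈ Finset.range (n + 1), ε ^ 2 ≤ (∑ k ∈ Finset.range k, ξ k ω) ^ 2} := by
    ext ω
    simp only [Set.mem_ofPred_eq, Set.mem_iUnion, Finset.mem_range, sq_le_sq, abs_of_pos hε]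
    exact ⟨fun ⟨n, hn⟩ => ⟨n, n, n.lt_succ_self, hn⟩, fun ⟨_, k, _, hk⟩ => ⟨k, hk⟩⟩
  -- The finite-horizon events increase, so Doob's bound for the squared sums passes to the limit.
  rw [hU, Monotone.measure_iUnion]
  · refine iSup_le fun n => ?_
    have hm := maximal_ineq h.submartingale_sum_sq (fun n ω => sq_nonneg _)
      (ε := (ε ^ 2).toNNReal) n
    simp only [Finset.le_sup'_iff, Real.coe_toNNReal _ (sq_nonneg ε)] at hm
    have hle := hm.trans (ENNReal.ofReal_le_ofReal ((setIntegral_le_integral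
      (h.submartingale_sum_sq.integrable n) (ae_of_all _ fun ω => sq_nonneg _)).trans
      ((h.integral_sum_sq n).le.trans (hT n))))
    rw [ENNReal.ofReal_div_of_pos (by positivity), ENNReal.le_div_iff_mul_le
      (Or.inl (by simpa using hε.ne')) (Or.inl ENNReal.ofReal_ne_top), mul_comm]
    exact hle
  · intro m n hmn ω
    rintro ⟨k, hk, hle⟩
    exact ⟨k, Finset.range_mono (by omega) hk, hle⟩

/-- Unbounded paths cross every level `m + 1`, an event of measure at most `T / (m + 1) ^ 2`. -/
lemma ae_bounded_sum (h : IsMartingaleDifference P ℱ ξ) {T : ℝ}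
    (hT : ∀ n, ∑ k ∈ Finset.range n, ∫ ω, ξ k ω ^ 2 ∂P ≤ T) :
    ∀ᵐ ω ∂P, ∃ K, ∀ n, |∑ k ∈ Finset.range n, ξ k ω| ≤ K := by
  rw [ae_iff]
  have hlim : Tendsto (fun m : ℕ => ENNReal.ofReal (T / ((m : ℝ) + 1) ^ 2)) atTop (𝓝 0) := by
    rw [← ENNReal.ofReal_zero]
    refine ENNReal.tendsto_ofReal (Tendsto.div_atTop tendsto_const_nhds ?_)
    exact (tendsto_pow_atTop two_ne_zero).comp
      (tendsto_atTop_add_const_right _ _ tendsto_natCast_atTop_atTop)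
  refine le_antisymm (ge_of_tendsto' hlim fun m => ?_) zero_le
  refine (measure_mono fun ω hω => ?_).trans
    (h.measure_exists_le_abs_sum (by positivity : (0 : ℝ) < m + 1) hT)
  simp only [Set.mem_ofPred_eq, not_exists, not_forall, not_le] at hω ⊢
  obtain ⟨n, hn⟩ := hω (m + 1)
  exact ⟨n, hn.le⟩

/-- Restricting to an initial event keeps the martingale structure and scales variances by its
probability. That factor cancels on conditioning, making the final bound independent of how likely
the event is. -/
lemma indicator (h : IsMartingaleDifference P ℱ ξ) {D : Set Ω}
    (hD : MeasurableSet[ℱ 0] D) :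
    IsMartingaleDifference P ℱ fun k => D.indicator (ξ k) where
  measurable k := (h.measurable k).indicator (ℱ.mono (Nat.zero_le _) _ hD)
  memLp k := (h.memLp k).indicator (ℱ.le 0 _ hD)
  condExp_eq_zero k := by
    filter_upwards [condExp_indicator ((h.memLp k).integrable one_le_two)
      (ℱ.mono (Nat.zero_le k) _ hD), h.condExp_eq_zero k] with ω h1 h2
    rw [h1]
    by_cases hω : ω ∈ D <;> simp [hω, h2]

/-- The maximal inequality on an event of the initial `σ`-algebra. -/
lemma measure_inter_exists_le_abs_sum (h : IsMartingaleDifference P ℱ ξ) {T ε : ℝ} (hε : 0 < ε)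
    {τ : ℕ → ℝ} (hτ : ∀ k, P[fun ω => ξ k ω ^ 2 | ℱ k] ≤ᵐ[P] fun _ => τ k)
    (hT : ∀ n, ∑ k ∈ Finset.range n, τ k ≤ T) {D : Set Ω} (hD : MeasurableSet[ℱ 0] D) :
    P (D ∩ {ω | ∃ n, ε ≤ |∑ k ∈ Finset.range n, ξ k ω|}) ≤
      P D * ENNReal.ofReal (T / ε ^ 2) := by
  have hint : ∀ k, ∫ ω, D.indicator (ξ k) ω ^ 2 ∂P ≤ P.real D * τ k := fun k => by
    have hDk : MeasurableSet[ℱ k] D := ℱ.mono (Nat.zero_le k) _ hD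
    have e : (fun ω => D.indicator (ξ k) ω ^ 2) = D.indicator fun ω => ξ k ω ^ 2 := by
      funext ω
      by_cases hω : ω ∈ D <;> simp [hω]
    rw [e, integral_indicator (ℱ.le 0 _ hD),
      ← setIntegral_condExp (ℱ.le k) (h.memLp k).integrable_sq hDk]
    refine (setIntegral_mono_ae integrable_condExp.integrableOn
      (integrable_const _).integrableOn (hτ k)).trans ?_
    simp
  have := (h.indicator hD).measure_exists_le_abs_sum hε (T := P.real D * T) fun n =>
    (Finset.sum_le_sum fun k _ => hint k).trans (by
      rw [← Finset.mul_sum]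
      exact mul_le_mul_of_nonneg_left (hT n) measureReal_nonneg)
  rw [mul_div_assoc, ENNReal.ofReal_mul measureReal_nonneg, ofReal_measureReal] at this
  refine (measure_mono ?_).trans this
  rintro ω ⟨hω, n, hn⟩
  exact ⟨n, by simpa [hω] using hn⟩

end IsMartingaleDifference

end MartingaleDifference

/-! ### Step-size sums. -/

namespace StochasticGame

section StepSize

lemma stepSize_pos {γ : ℝ} (hγ : 0 < γ) (p : ℝ) (k : ℕ) : 0 < stepSize γ p k := by
  unfold stepSize
  positivity

lemma tendsto_sum_stepSize_atTop {γ p : ℝ} (hγ : 0 < γ) (hp : p ≤ 1) :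
    Tendsto (fun n => ∑ k ∈ Finset.range n, stepSize γ p k) atTop atTop := by
  refine tendsto_atTop_mono (fun n => ?_)
    (Real.tendsto_sum_range_one_div_nat_succ_atTop.const_mul_atTop hγ)
  rw [Finset.mul_sum]
  refine Finset.sum_le_sum fun k _ => ?_
  rw [mul_one_div, stepSize]
  refine div_le_div_of_nonneg_left hγ.le (by positivity) ?_
  conv_rhs => rw [← Real.rpow_one ((k : ℝ) + 1)]
  exact Real.rpow_le_rpow_of_exponent_le (by linarith [Nat.cast_nonneg (α := ℝ) k]) hp

/-- Past some index `g` is below `c / 2`, so up to a constant the sum is at most `c / 2` times the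
divergent sum of step sizes. -/
lemma tendsto_sum_stepSize_mul_atBot {γ p : ℝ} (hγ : 0 < γ) (hp : p ≤ 1) {g : ℕ → ℝ} {c : ℝ} (hc : c < 0)
    (hg : Tendsto g atTop (𝓝 c)) :
    Tendsto (fun n => ∑ k ∈ Finset.range n, stepSize γ p k * g k) atTop atBot := by
  obtain ⟨m, hm⟩ := eventually_atTop.1 (hg.eventually_lt_const (show c < c / 2 by linarith))
  have h1 : Tendsto (fun n => (∑ k ∈ Finset.range m, stepSize γ p k * (g k - c / 2))
      + c / 2 * ∑ k ∈ Finset.range n, stepSize γ p k) atTop atBot :=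
    tendsto_atBot_add_const_left _ _
      ((tendsto_sum_stepSize_atTop hγ hp).const_mul_atTop_of_neg (by linarith))
  refine tendsto_atBot_mono' _ ?_ h1
  filter_upwards [eventually_ge_atTop m] with n hn
  have h2 : ∑ k ∈ Finset.range n, stepSize γ p k * (g k - c / 2) ≤
      ∑ k ∈ Finset.range m, stepSize γ p k * (g k - c / 2) := by
    rw [← Finset.sum_range_add_sum_Ico _ hn]
    have : ∑ k ∈ Finset.Ico m n, stepSize γ p k * (g k - c / 2) ≤ 0 :=
      Finset.sum_nonpos fun k hk => mul_nonpos_of_nonneg_of_nonpos (stepSize_pos hγ p k).le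
        (by linarith [hm k (Finset.mem_Ico.1 hk).1])
    linarith
  simp only [mul_sub, Finset.sum_sub_distrib, ← Finset.sum_mul] at h2 ⊢
  linarith

lemma summable_of_isBigO_add_one_rpow {f : ℕ → ℝ} {q : ℝ} (hq : q < -1)
    (hf : f =O[atTop] fun k : ℕ => ((k : ℝ) + 1) ^ q) : Summable f := by
  refine summable_of_isBigO_nat ?_ hf
  have := (summable_nat_add_iff 1).2 (Real.summable_nat_rpow.2 hq)
  simpa using this

lemma summable_stepSize_mul_abs {p b : ℝ} (hpb : 1 < p + b) {B : ℕ → ℝ}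
    (hB : B =O[atTop] fun k : ℕ => 1 / ((k : ℝ) + 1) ^ b) :
    Summable fun k => stepSize 1 p k * |B k| := by
  refine summable_of_isBigO_add_one_rpow (q := -(p + b)) (by linarith) ?_
  have h := (Asymptotics.isBigO_refl (fun k : ℕ => stepSize 1 p k) atTop).mul hB.abs_left
  refine h.congr_right fun k => ?_
  have hk : (0 : ℝ) < (k : ℝ) + 1 := by positivity
  rw [stepSize, Real.rpow_neg hk.le, Real.rpow_add hk]
  field_simp

lemma summable_stepSize_sq_mul_sq {p s : ℝ} (hps : 1 / 2 < p - s) {σ : ℕ → ℝ}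
    (hσ : σ =O[atTop] fun k : ℕ => ((k : ℝ) + 1) ^ s) :
    Summable fun k => stepSize 1 p k ^ 2 * σ k ^ 2 := by
  refine summable_of_isBigO_add_one_rpow (q := 2 * (s - p)) (by linarith) ?_
  have h := ((Asymptotics.isBigO_refl (fun k : ℕ => stepSize 1 p k) atTop).mul hσ).pow 2
  refine (h.congr_left fun k => mul_pow _ _ _).congr_right fun k => ?_
  have hk : (0 : ℝ) < (k : ℝ) + 1 := by positivity
  rw [stepSize, mul_comm 2, Real.rpow_mul hk.le, Real.rpow_sub hk, Real.rpow_two]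
  field_simp

/-- Factoring out `γ` makes the bias budget linear and the variance budget quadratic in `γ`. -/
lemma stepSize_eq_mul (γ p : ℝ) (k : ℕ) : stepSize γ p k = γ * stepSize 1 p k := by
  simp [stepSize, div_eq_mul_inv]

lemma stepSize_one_nonneg (p : ℝ) (k : ℕ) : 0 ≤ stepSize 1 p k := (stepSize_pos one_pos p k).le

lemma sum_stepSize_mul_abs_le {γ p : ℝ} (hγ : 0 < γ) {B : ℕ → ℝ}
    (hB : Summable fun k => stepSize 1 p k * |B k|) (n : ℕ) :
    ∑ k ∈ Finset.range n, stepSize γ p k * |B k| ≤ γ * ∑' k, stepSize 1 p k * |B k| := by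
  simp only [stepSize_eq_mul γ, mul_assoc, ← Finset.mul_sum]
  exact mul_le_mul_of_nonneg_left (hB.sum_le_tsum _ fun k _ =>
    mul_nonneg (stepSize_one_nonneg p k) (abs_nonneg _)) hγ.le

lemma sum_stepSize_sq_mul_sq_le {γ p : ℝ} {σ : ℕ → ℝ}
    (hσ : Summable fun k => stepSize 1 p k ^ 2 * σ k ^ 2) (n : ℕ) :
    ∑ k ∈ Finset.range n, stepSize γ p k ^ 2 * σ k ^ 2 ≤
      γ ^ 2 * ∑' k, stepSize 1 p k ^ 2 * σ k ^ 2 := by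
  simp only [stepSize_eq_mul γ, mul_pow, mul_assoc, ← Finset.mul_sum]
  exact mul_le_mul_of_nonneg_left (hσ.sum_le_tsum _ fun k _ => by positivity) (sq_nonneg _)

end StepSize

/-! ### Decomposition of the score process into drift, noise and bias. -/

namespace IsLPG

variable {ι S : Type*} {A : ι → Type*} [Fintype ι] [DecidableEq ι] [Fintype S]
  [∀ i, Fintype (A i)] {G : StochasticGame ι S A} {Ω : Type*} {mΩ : MeasurableSpace Ω}
  {P : Measure Ω} {ℱ : Filtration ℕ mΩ} {γ p : ℝ} {B σ : ℕ → ℝ}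
  {y π v : ℕ → Ω → ScoreSpace ι S A}

lemma policy_mem (h : G.IsLPG P ℱ γ p B σ y π v) (k : ℕ) (ω : Ω) :
    π k ω ∈ policies ι S A := (h.policy_eq k ω).1

/-- The policy is a continuous function of the adapted score, and the gradient is continuous on
policies. -/
lemma stronglyMeasurable_policyGradient (h : G.IsLPG P ℱ γ p B σ y π v)
    (hne : (policies ι S A).Nonempty) (k : ℕ) :
    StronglyMeasurable[ℱ k] fun ω => G.policyGradient (π k ω) := by
  obtain ⟨f, hf, hproj⟩ := exists_isProjection_continuous
    (convex_policies (ι := ι) (S := S) (A := A)) isCompact_policies hne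
  have he : ∀ ω, π k ω = f (y k ω) := fun ω => dist_le_zero.1 <| by
    simpa using (h.policy_eq k ω).dist_le_dist convex_policies (hproj (y k ω))
  have hc : Continuous fun z => G.policyGradient (f z) :=
    G.continuousOn_policyGradient.comp_continuous hf fun z => (hproj z).1
  simp only [he]
  exact hc.comp_stronglyMeasurable (h.measurable_score k)

lemma stronglyMeasurable_noise (h : G.IsLPG P ℱ γ p B σ y π v) (hγ : 0 < γ) (k : ℕ) :
    StronglyMeasurable[ℱ (k + 1)] (noise P ℱ v k) := by
  have hle := ℱ.mono (Nat.le_succ k)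
  -- Adaptedness is assumed for the scores only; two consecutive scores recover the estimate, known
  -- at time `k + 1`.
  have hv : v k = fun ω => (stepSize γ p k)⁻¹ • (y (k + 1) ω - y k ω) := by
    funext ω
    rw [h.score_succ, add_sub_cancel_left, inv_smul_smul₀ (stepSize_pos hγ p k).ne']
  have hv' : StronglyMeasurable[ℱ (k + 1)] (v k) := by
    rw [hv]
    exact StronglyMeasurable.const_smul (𝕜 := ℝ)
      ((h.measurable_score (k + 1)).sub ((h.measurable_score k).mono hle)) _
  exact hv'.sub (stronglyMeasurable_condExp.mono hle)

lemma map_score (h : G.IsLPG P ℱ γ p B σ y π v) (L : ScoreSpace ι S A →L[ℝ] ℝ) (n : ℕ)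
    (ω : Ω) : L (y n ω) = L (y 0 ω)
      + ∑ k ∈ Finset.range n, stepSize γ p k * L (G.policyGradient (π k ω))
      + ∑ k ∈ Finset.range n, stepSize γ p k * L (noise P ℱ v k ω)
      + ∑ k ∈ Finset.range n, stepSize γ p k * L (G.bias P ℱ v π k ω) := by
  induction n with
  | zero => simp
  | succ n ih =>
    have e : v n ω = G.policyGradient (π n ω) + noise P ℱ v n ω + G.bias P ℱ v π n ω := by
      simp only [noise, bias]
      abel
    rw [h.score_succ, map_add, ih, e]
    simp only [Finset.sum_range_succ, map_smul, map_add, smul_eq_mul]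
    ring

lemma abs_sum_bias_le (hγ : 0 < γ) {L : ScoreSpace ι S A →L[ℝ] ℝ}
    (hL : ∀ x, |L x| ≤ 2 * ‖x‖) (hB : Summable fun k => stepSize 1 p k * |B k|) {ω : Ω}
    (hω : ∀ k, ‖G.bias P ℱ v π k ω‖ ≤ B k) (n : ℕ) :
    |∑ k ∈ Finset.range n, stepSize γ p k * L (G.bias P ℱ v π k ω)| ≤
      2 * (γ * ∑' k, stepSize 1 p k * |B k|) := by
  refine (Finset.abs_sum_le_sum_abs _ _).trans ?_
  refine le_trans ?_ (mul_le_mul_of_nonneg_left (sum_stepSize_mul_abs_le hγ hB n) zero_le_two)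
  rw [Finset.mul_sum]
  refine Finset.sum_le_sum fun k _ => ?_
  rw [abs_mul, abs_of_pos (stepSize_pos hγ p k), mul_left_comm]
  refine mul_le_mul_of_nonneg_left ((hL _).trans ?_) (stepSize_pos hγ p k).le
  linarith [hω k, le_abs_self (B k)]

variable [IsProbabilityMeasure P]

/-- The bias is already `ℱ k`-measurable, so its conditional bound is a pathwise one. -/
lemma ae_norm_bias_le (h : G.IsLPG P ℱ γ p B σ y π v) (hne : (policies ι S A).Nonempty)
    (k : ℕ) : ∀ᵐ ω ∂P, ‖G.bias P ℱ v π k ω‖ ≤ B k := by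
  have hg := h.stronglyMeasurable_policyGradient hne k
  obtain ⟨C, hC⟩ := (isCompact_policies (ι := ι) (S := S) (A := A)).exists_bound_of_continuousOn
    G.continuousOn_policyGradient
  have hgi : Integrable (fun ω => G.policyGradient (π k ω)) P :=
    Integrable.of_bound (hg.mono (ℱ.le k)).aestronglyMeasurable C
      (ae_of_all _ fun ω => hC _ (h.policy_mem k ω))
  have hm : StronglyMeasurable[ℱ k] fun ω => ‖G.bias P ℱ v π k ω‖ :=
    (stronglyMeasurable_condExp.sub hg).norm
  have hi : Integrable (fun ω => ‖G.bias P ℱ v π k ω‖) P := (integrable_condExp.sub hgi).norm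
  have hb := h.bias_le k
  rwa [condExp_of_stronglyMeasurable (ℱ.le k) hm hi] at hb

lemma condExp_noise (h : G.IsLPG P ℱ γ p B σ y π v) (k : ℕ) :
    P[noise P ℱ v k | ℱ k] =ᵐ[P] 0 := by
  have e : noise P ℱ v k = v k - P[v k | ℱ k] := rfl
  rw [e]
  filter_upwards [condExp_sub (h.integrable_estimate k)
    (integrable_condExp (μ := P) (m := ℱ k) (f := v k)) (ℱ k)] with ω h1
  rw [h1, condExp_of_stronglyMeasurable (ℱ.le k) stronglyMeasurable_condExp integrable_condExp]
  simp

lemma isMartingaleDifference_noise (h : G.IsLPG P ℱ γ p B σ y π v) (hγ : 0 < γ)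
    (L : ScoreSpace ι S A →L[ℝ] ℝ) :
    IsMartingaleDifference P ℱ fun k ω => stepSize γ p k * L (noise P ℱ v k ω) where
  measurable k :=
    (L.continuous.comp_stronglyMeasurable (h.stronglyMeasurable_noise hγ k)).const_mul _
  memLp k := by
    have : MemLp (noise P ℱ v k) 2 P := (memLp_two_iff_integrable_sq_norm
      ((h.stronglyMeasurable_noise hγ k).mono (ℱ.le _)).aestronglyMeasurable).2
      (h.integrable_noise_sq k)
    exact (L.comp_memLp' this).const_mul _
  condExp_eq_zero k := by
    have hi : Integrable (noise P ℱ v k) P := (h.integrable_estimate k).sub integrable_condExp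
    have e : (fun ω => stepSize γ p k * L (noise P ℱ v k ω)) =
        (stepSize γ p k • L) ∘ noise P ℱ v k := rfl
    rw [e]
    filter_upwards [(stepSize γ p k • L).comp_condExp_comm (m := ℱ k) hi, h.condExp_noise k]
      with ω h1 h2
    rw [← h1, Function.comp_apply, h2]
    simp

lemma condExp_noise_sq_le (h : G.IsLPG P ℱ γ p B σ y π v) (hγ : 0 < γ)
    {L : ScoreSpace ι S A →L[ℝ] ℝ} (hL : ∀ x, |L x| ≤ 2 * ‖x‖) (k : ℕ) :
    P[fun ω => (stepSize γ p k * L (noise P ℱ v k ω)) ^ 2 | ℱ k] ≤ᵐ[P]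
      fun _ => 4 * (stepSize γ p k ^ 2 * σ k ^ 2) := by
  filter_upwards [condExp_mono (m := ℱ k)
      ((h.isMartingaleDifference_noise hγ L).memLp k).integrable_sq
      ((h.integrable_noise_sq k).smul (4 * stepSize γ p k ^ 2)) (ae_of_all _ fun ω => by
        have h1 := hL (noise P ℱ v k ω)
        have h2 : L (noise P ℱ v k ω) ^ 2 ≤ (2 * ‖noise P ℱ v k ω‖) ^ 2 :=
          sq_le_sq' (neg_le_of_abs_le h1) (le_of_abs_le h1)
        have h3 := mul_le_mul_of_nonneg_left h2 (sq_nonneg (stepSize γ p k))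
        simp only [Pi.smul_apply, smul_eq_mul]
        linarith),
    condExp_smul (μ := P) (4 * stepSize γ p k ^ 2) (fun ω => ‖noise P ℱ v k ω‖ ^ 2) (ℱ k),
    h.noise_le k] with ω h1 h2 h3
  refine h1.trans (h2.trans_le ?_)
  rw [Pi.smul_apply, smul_eq_mul, ← mul_assoc]
  exact mul_le_mul_of_nonneg_left h3 (by positivity)

end IsLPG

end StochasticGame

/-! ### The open set of good initial scores. -/

section Basin

variable {ι S : Type*} {A : ι → Type*}

/-- The scores whose entries at the actions `α` exceed all other entries by more than two. -/
def dominanceRegion (α : ∀ i, S → A i) : Set (ScoreSpace ι S A) :=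
  {x | ∀ i s a, a ≠ α i s → entryGap i s a (α i s) x < -2}

lemma isOpen_dominanceRegion [Finite ι] [Finite S] [∀ i, Finite (A i)] (α : ∀ i, S → A i) :
    IsOpen (dominanceRegion α) := by
  simp only [dominanceRegion, Set.ofPred_forall]
  exact isOpen_iInter_of_finite fun i => isOpen_iInter_of_finite fun s =>
    isOpen_iInter_of_finite fun a => isOpen_iInter_of_finite fun _ =>
      isOpen_lt (entryGap i s a (α i s)).continuous continuous_const

lemma not_isBounded_dominanceRegion [Fintype ι] [Fintype S] [∀ i, Fintype (A i)] [Nonempty ι]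
    [Nonempty S] {x : ScoreSpace ι S A} (hx : x ∈ policies ι S A) {α : ∀ i, S → A i}
    (hα : ∀ i s, x ⟨i, s, α i s⟩ = 1) : ¬ Bornology.IsBounded (dominanceRegion α) := by
  intro hb
  obtain ⟨C, hC⟩ := isBounded_iff_forall_norm_le.1 hb
  have i := Classical.arbitrary ι
  have s := Classical.arbitrary S
  -- All gaps of this multiple are at most -3, while its entry at a chosen action exceeds `C`.
  have hmem : (|C| + 3) • x ∈ dominanceRegion α := fun j s' a ha => by
    rw [entryGap_apply, PiLp.smul_apply, PiLp.smul_apply, hα,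
      eq_zero_of_eq_one hx (hα j s') ha]
    simp only [smul_eq_mul]
    linarith [abs_nonneg C]
  have h1 := hC _ hmem
  have h2 := PiLp.norm_apply_le ((|C| + 3) • x) ⟨i, s, α i s⟩
  rw [PiLp.smul_apply, hα, smul_eq_mul, mul_one, Real.norm_eq_abs] at h2
  linarith [le_abs_self C, le_abs_self (|C| + 3)]

end Basin

/-! ### Trapping at the vertex and finite-time identification. -/

namespace StochasticGame.IsLPG

variable {ι S : Type*} {A : ι → Type*} [Fintype ι] [DecidableEq ι] [Fintype S]
  [∀ i, Fintype (A i)] {G : StochasticGame ι S A} {Ω : Type*} {mΩ : MeasurableSpace Ω}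
  {P : Measure Ω} {ℱ : Filtration ℕ mΩ} {γ p : ℝ} {B σ : ℕ → ℝ}
  {y π v : ℕ → Ω → ScoreSpace ι S A} {x : ScoreSpace ι S A} {α : ∀ i, S → A i}

/-- Started in the dominance region, the policies never leave `x` as long as the accumulated
noise and bias stay below one half. -/
lemma policy_eq_of_noise_le (h : G.IsLPG P ℱ γ p B σ y π v) (hγ : 0 < γ)
    (hx : x ∈ policies ι S A) (hα : ∀ i s, x ⟨i, s, α i s⟩ = 1)
    (hneg : ∀ i s a, a ≠ α i s → entryGap i s a (α i s) (G.policyGradient x) < 0)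
    {ω : Ω} (h0 : y 0 ω ∈ dominanceRegion α)
    (hnoise : ∀ i s a n, |∑ k ∈ Finset.range n,
      stepSize γ p k * entryGap i s a (α i s) (noise P ℱ v k ω)| ≤ 1 / 2)
    (hbias : ∀ i s a n, |∑ k ∈ Finset.range n,
      stepSize γ p k * entryGap i s a (α i s) (G.bias P ℱ v π k ω)| ≤ 1 / 2) (n : ℕ) :
    π n ω = x := by
  induction n using Nat.strong_induction_on with
  | _ n ih =>
    refine (h.policy_eq n ω).eq_of_entryGap_le hx hα fun i s a ha => ?_
    -- All earlier policies equal `x`, so the drift has the favourable sign; the gap is then below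
    -- -2 + 1/2 + 1/2 = -1.
    have hdrift : ∑ k ∈ Finset.range n,
        stepSize γ p k * entryGap i s a (α i s) (G.policyGradient (π k ω)) ≤ 0 :=
      Finset.sum_nonpos fun k hk => by
        rw [ih k (Finset.mem_range.1 hk)]
        exact mul_nonpos_of_nonneg_of_nonpos (stepSize_pos hγ p k).le (hneg i s a ha).le
    rw [h.map_score]
    linarith [h0 i s a ha, le_of_abs_le (hnoise i s a n), le_of_abs_le (hbias i s a n)]

variable [IsProbabilityMeasure P]

lemma sum_noise_variance_le (hσ : Summable fun k => stepSize 1 p k ^ 2 * σ k ^ 2) (n : ℕ) :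
    ∑ k ∈ Finset.range n, 4 * (stepSize γ p k ^ 2 * σ k ^ 2) ≤
      4 * (γ ^ 2 * ∑' k, stepSize 1 p k ^ 2 * σ k ^ 2) := by
  rw [← Finset.mul_sum]
  exact mul_le_mul_of_nonneg_left (sum_stepSize_sq_mul_sq_le hσ n) (by norm_num)

lemma ae_eventually_eq_of_tendsto (h : G.IsLPG P ℱ γ p B σ y π v) (hγ : 0 < γ) (hp : p ≤ 1)
    (hB : Summable fun k => stepSize 1 p k * |B k|)
    (hσ : Summable fun k => stepSize 1 p k ^ 2 * σ k ^ 2)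
    (hx : x ∈ policies ι S A) (hα : ∀ i s, x ⟨i, s, α i s⟩ = 1)
    (hneg : ∀ i s a, a ≠ α i s → entryGap i s a (α i s) (G.policyGradient x) < 0) :
    ∀ᵐ ω ∂P, Tendsto (fun k => π k ω) atTop (𝓝 x) → ∃ m, ∀ k, m ≤ k → π k ω = x := by
  have hnoise : ∀ᵐ ω ∂P, ∀ j : (i : ι) × S × A i, ∃ K, ∀ n, |∑ k ∈ Finset.range n,
      stepSize γ p k * entryGap j.1 j.2.1 j.2.2 (α j.1 j.2.1) (noise P ℱ v k ω)| ≤ K := by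
    rw [ae_all_iff]
    intro j
    have hd := h.isMartingaleDifference_noise hγ (entryGap j.1 j.2.1 j.2.2 (α j.1 j.2.1))
    refine hd.ae_bounded_sum (T := 4 * (γ ^ 2 * ∑' k, stepSize 1 p k ^ 2 * σ k ^ 2)) fun n =>
      (Finset.sum_le_sum fun k _ => ?_).trans (sum_noise_variance_le hσ n)
    rw [← integral_condExp (ℱ.le k)]
    refine (integral_mono_ae integrable_condExp (integrable_const _)
      (h.condExp_noise_sq_le hγ (abs_entryGap_le _ _ _ _) k)).trans ?_
    simp
  filter_upwards [hnoise, ae_all_iff.2 (h.ae_norm_bias_le ⟨x, hx⟩)] with ω hω hb hlim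
  have hgrad : Tendsto (fun k => G.policyGradient (π k ω)) atTop (𝓝 (G.policyGradient x)) :=
    (G.continuousOn_policyGradient x hx).tendsto.comp
      (tendsto_nhdsWithin_iff.2 ⟨hlim, Eventually.of_forall fun k => h.policy_mem k ω⟩)
  have hev : ∀ᶠ n in atTop, ∀ j : (i : ι) × S × A i, j.2.2 ≠ α j.1 j.2.1 →
      entryGap j.1 j.2.1 j.2.2 (α j.1 j.2.1) (y n ω) ≤ -1 := by
    rw [eventually_all]
    rintro ⟨i, s, a⟩
    by_cases ha : a = α i s
    · simp [ha]
    obtain ⟨K, hK⟩ := hω ⟨i, s, a⟩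
    have hdrift := tendsto_sum_stepSize_mul_atBot hγ hp (hneg i s a ha)
      (((entryGap i s a (α i s)).continuous.tendsto _).comp hgrad)
    filter_upwards [hdrift.eventually_le_atBot (-1 - entryGap i s a (α i s) (y 0 ω) - K -
      2 * (γ * ∑' k, stepSize 1 p k * |B k|))] with n hn _
    have h1 := le_of_abs_le (hK n)
    have h2 := le_of_abs_le (abs_sum_bias_le hγ (abs_entryGap_le i s a (α i s)) hB hb n)
    simp only [Function.comp_apply] at hn
    simp only [h.map_score _ n ω] at h1 ⊢
    linarith
  obtain ⟨m, hm⟩ := eventually_atTop.1 hev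
  exact ⟨m, fun k hk => (h.policy_eq k ω).eq_of_entryGap_le hx hα
    fun i s a ha => hm k hk ⟨i, s, a⟩ ha⟩

/-- Union bound over the gap processes. The factor 16 is 4, from `|L x| ≤ 2 * ‖x‖` squared, over the
square of the threshold 1/2. -/
lemma le_cond_forall_eq (h : G.IsLPG P ℱ γ p B σ y π v) (hγ : 0 < γ)
    (hB : Summable fun k => stepSize 1 p k * |B k|)
    (hσ : Summable fun k => stepSize 1 p k ^ 2 * σ k ^ 2)
    (hx : x ∈ policies ι S A) (hα : ∀ i s, x ⟨i, s, α i s⟩ = 1)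
    (hneg : ∀ i s a, a ≠ α i s → entryGap i s a (α i s) (G.policyGradient x) < 0)
    (hγB : 2 * (γ * ∑' k, stepSize 1 p k * |B k|) ≤ 1 / 2) {δ : ℝ}
    (hγσ : Fintype.card ((i : ι) × S × A i) *
      (16 * (γ ^ 2 * ∑' k, stepSize 1 p k ^ 2 * σ k ^ 2)) ≤ δ)
    (hD : P (y 0 ⁻¹' dominanceRegion α) ≠ 0) :
    1 - δ ≤ (P[|y 0 ⁻¹' dominanceRegion α]).real {ω | ∀ k, π k ω = x} := by
  set D := y 0 ⁻¹' dominanceRegion α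
  have hDm : MeasurableSet[ℱ 0] D :=
    (h.measurable_score 0).measurable (isOpen_dominanceRegion α).measurableSet
  set T := ∑' k, stepSize 1 p k ^ 2 * σ k ^ 2
  have hT : 0 ≤ T := tsum_nonneg fun k => by positivity
  let bad : (i : ι) × S × A i → Set Ω := fun j => {ω | ∃ n, 1 / 2 ≤ |∑ k ∈ Finset.range n,
      stepSize γ p k * entryGap j.1 j.2.1 j.2.2 (α j.1 j.2.1) (noise P ℱ v k ω)|}
  have hbad : ∀ j, P (D ∩ bad j) ≤ P D * ENNReal.ofReal (16 * (γ ^ 2 * T)) := fun j => by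
    have := (h.isMartingaleDifference_noise hγ
      (entryGap j.1 j.2.1 j.2.2 (α j.1 j.2.1))).measure_inter_exists_le_abs_sum one_half_pos
      (h.condExp_noise_sq_le hγ (abs_entryGap_le _ _ _ _)) (sum_noise_variance_le hσ) hDm
    refine this.trans_eq ?_
    congr 2
    ring
  have hsub : (D ∩ {ω | ∀ k, π k ω = x}ᶜ : Set Ω) ≤ᵐ[P] ⋃ j, D ∩ bad j := by
    filter_upwards [ae_all_iff.2 (h.ae_norm_bias_le ⟨x, hx⟩)] with ω hb
    rintro ⟨hωD, hω⟩
    by_contra hnot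
    refine hω (h.policy_eq_of_noise_le hγ hx hα hneg hωD (fun i s a n => ?_)
      fun i s a n => (abs_sum_bias_le hγ (abs_entryGap_le i s a (α i s)) hB hb n).trans hγB)
    by_contra! hlt
    exact hnot (Set.mem_iUnion.2 ⟨⟨i, s, a⟩, hωD, n, hlt.le⟩)
  have hle : P (D ∩ {ω | ∀ k, π k ω = x}ᶜ) ≤ P D * ENNReal.ofReal δ := by
    refine (measure_mono_ae hsub).trans ((measure_iUnion_fintype_le _ _).trans
      ((Finset.sum_le_sum fun j _ => hbad j).trans ?_))
    rw [Finset.sum_const, nsmul_eq_mul, mul_left_comm, Finset.card_univ,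
      ← ENNReal.ofReal_natCast, ← ENNReal.ofReal_mul (Nat.cast_nonneg _)]
    gcongr
  have hcond : (P[|D]) {ω | ∀ k, π k ω = x}ᶜ ≤ ENNReal.ofReal δ := by
    rw [cond_apply (ℱ.le 0 _ hDm)]
    refine (mul_le_mul_right hle _).trans_eq ?_
    rw [← mul_assoc, ENNReal.inv_mul_cancel hD (measure_ne_top _ _), one_mul]
  have hδ : 0 ≤ δ := le_trans (by positivity) hγσ
  have := cond_isProbabilityMeasure hD
  have h1 : (P[|D]).real {ω | ∀ k, π k ω = x}ᶜ ≤ δ := ENNReal.toReal_le_of_le_ofReal hδ hcond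
  have h2 := measureReal_union_le (μ := P[|D]) {ω | ∀ k, π k ω = x} {ω | ∀ k, π k ω = x}ᶜ
  rw [Set.union_compl_self, probReal_univ] at h2
  linarith

end StochasticGame.IsLPG

/-! ### The main theorem. -/

open StochasticGame in
theorem mainTheorem3 {ι S : Type*} {A : ι → Type*}
    [Fintype ι] [DecidableEq ι] [Nonempty ι] [Fintype S] [∀ i, Fintype (A i)]
    (G : StochasticGame ι S A) (πs : ScoreSpace ι S A) (hπs : G.IsStrictNash πs)
    (p b s : ℝ) (hp : p ≤ 1) (hpb : 1 < p + b) (hps : 1 / 2 < p - s)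
    (B σ : ℕ → ℝ)
    (hB : B =O[atTop] fun k : ℕ => 1 / ((k : ℝ) + 1) ^ b)
    (hσ : σ =O[atTop] fun k : ℕ => ((k : ℝ) + 1) ^ s) :
    ∃ D : Set (ScoreSpace ι S A), IsOpen D ∧ ¬ Bornology.IsBounded D ∧
      ∀ δ : ℝ, 0 < δ → ∃ γ₀ : ℝ, 0 < γ₀ ∧ ∀ γ : ℝ, 0 < γ → γ ≤ γ₀ → ∃ k₀ : ℕ,
        ∀ (Ω : Type*) (mΩ : MeasurableSpace Ω) (P : Measure Ω), IsProbabilityMeasure P →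
          ∀ (ℱ : Filtration ℕ mΩ) (y π v : ℕ → Ω → ScoreSpace ι S A),
            G.IsLPG P ℱ γ p B σ y π v →
              (P (y 0 ⁻¹' D) ≠ 0 →
                1 - δ ≤ (P[|y 0 ⁻¹' D]).real
                    {ω | Tendsto (fun k => π k ω) atTop (𝓝 πs)} ∧
                1 - δ ≤ (P[|y 0 ⁻¹' D]).real {ω | ∀ k, k₀ ≤ k → π k ω = πs}) ∧
              ∀ᵐ ω ∂P, Tendsto (fun k => π k ω) atTop (𝓝 πs) →
                ∃ m : ℕ, ∀ k, m ≤ k → π k ω = πs := by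
  obtain ⟨-, ⟨hx, hdet⟩, hstrict⟩ := hπs
  choose α hα using hdet
  have : Nonempty S := by
    by_contra hS
    have := not_nonempty_iff.1 hS
    simpa using G.init_sum
  have hneg := entryGap_neg_of_inner_neg hx hα hstrict
  have hB' := summable_stepSize_mul_abs hpb hB
  have hσ' := summable_stepSize_sq_mul_sq hps hσ
  refine ⟨dominanceRegion α, isOpen_dominanceRegion α, not_isBounded_dominanceRegion hx hα,
    fun δ hδ => ?_⟩
  set T := ∑' k, stepSize 1 p k * |B k| with hTdef
  set V := Fintype.card ((i : ι) × S × A i) * (16 * ∑' k, stepSize 1 p k ^ 2 * σ k ^ 2)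
    with hVdef
  have hT : 0 ≤ T := tsum_nonneg fun k => mul_nonneg (stepSize_one_nonneg p k) (abs_nonneg _)
  have hV : 0 ≤ V := mul_nonneg (Nat.cast_nonneg _)
    (mul_nonneg (by norm_num) (tsum_nonneg fun k => by positivity))
  -- The three bounds give `γ ^ 2 ≤ γ`, `2 * (γ * T) ≤ 1 / 2` and `γ * V ≤ δ`; adding 1 keeps the
  -- denominators positive. On the good event the policy equals `πs` from the start, so `k₀ = 0`
  -- works and convergence is that of a constant sequence.
  refine ⟨min 1 (min (1 / (4 * (T + 1))) (δ / (V + 1))), by positivity,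
    fun γ hγ hγ₀ => ⟨0, fun Ω mΩ P hP ℱ y π v h => ⟨fun hD => ?_,
      h.ae_eventually_eq_of_tendsto hγ hp hB' hσ' hx hα hneg⟩⟩⟩
  simp only [le_min_iff] at hγ₀
  obtain ⟨hγ1, hγT, hγV⟩ := hγ₀
  rw [le_div_iff₀ (by positivity)] at hγT hγV
  have hmain := h.le_cond_forall_eq hγ hB' hσ' hx hα hneg (δ := δ)
    (by rw [← hTdef]; nlinarith) (by
      calc _ = γ ^ 2 * V := by rw [hVdef]; ring
        _ ≤ γ * V := mul_le_mul_of_nonneg_right (by nlinarith) hV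
        _ ≤ δ := by nlinarith) hD
  refine ⟨hmain.trans (measureReal_mono fun ω hω => ?_),
    hmain.trans (measureReal_mono fun ω hω k _ => hω k)⟩
  have : (fun k => π k ω) = fun _ => πs := funext hω
  rw [Set.mem_ofPred_eq, this]
  exact tendsto_const_nhds
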